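/- Let $(R,\mathfrak m)$ be a commutative Noetherian local ring of Krull dimension $n$, let $\mathfrak a$ be an ideal of $R$, let $N$ be an arbitrary $R$-module, and let $M$ be a nonzero finitely generated $R$-module whose projective dimension $d=\operatorname{pd}_R(M)$ is finite. For $i\ge 0$ let $$H^i_{\mathfrak a}(M,N)=\varinjlim_{k}\operatorname{Ext}^i_R(M/\mathfrak a^kM,N)$$ be the $i$-th generalized local cohomology module, the transition maps being induced by the natural surjections $M/\mathfrak a^{m}M\to M/\mathfrak a^{k}M$ for $k\le m$. If $n+d\ge 1$, then the set $$\operatorname{Supp}_R H^{\,n+d-1}_{\mathfrak a}(M,N)$$ of prime ideals $\mathfrak p$ of $R$ with $H^{\,n+d-1}_{\mathfrak a}(M,N)_{\mathfrak p}\neq 0$ is finite. -/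

import Mathlib

open CategoryTheory

universe u

namespace GenLocalCohomology

noncomputable section

variable {R : Type u} [CommRing R]

/-- The natural surjection `M / 𝔞^m M → M / 𝔞^k M` for `k ≤ m`. -/
def quotMap (a : Ideal R) (M : Type u) [AddCommGroup M] [Module R M] {k m : ℕ} (h : k ≤ m) :
    (M ⧸ (a ^ m • ⊤ : Submodule R M)) →ₗ[R] (M ⧸ (a ^ k • ⊤ : Submodule R M)) :=
  Submodule.factor (Submodule.smul_mono_left (Ideal.pow_le_pow_right h))

/-- The module `Ext^i_R(M / 𝔞^k M, N)`. -/
abbrev extQuot (a : Ideal R) (M N : Type u) [AddCommGroup M] [Module R M]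
    [AddCommGroup N] [Module R N] (i k : ℕ) : Type u :=
  Abelian.Ext (ModuleCat.of R (M ⧸ (a ^ k • ⊤ : Submodule R M))) (ModuleCat.of R N) i

/-- The transition map `Ext^i_R(M / 𝔞^k M, N) → Ext^i_R(M / 𝔞^m M, N)` for `k ≤ m`, induced
by the natural surjection `M / 𝔞^m M → M / 𝔞^k M`. -/
def extMap (a : Ideal R) (M N : Type u) [AddCommGroup M] [Module R M]
    [AddCommGroup N] [Module R N] (i k m : ℕ) (h : k ≤ m) :
    extQuot a M N i k →ₗ[R] extQuot a M N i m :=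
  (Abelian.Ext.mk₀ (ModuleCat.ofHom (quotMap a M h))).precompOfLinear R
    (ModuleCat.of R N) (zero_add i)

end

end GenLocalCohomology

/-- The `i`-th generalized local cohomology module of `M` and `N` with respect to `𝔞`,
`H^i_𝔞(M, N) = colim_k Ext^i_R(M / 𝔞^k M, N)`. -/
abbrev GenLocalCohomology {R : Type u} [CommRing R] (a : Ideal R) (M N : Type u)
    [AddCommGroup M] [Module R M] [AddCommGroup N] [Module R N] (i : ℕ) : Type u :=
  Module.DirectLimit (GenLocalCohomology.extQuot a M N i) (GenLocalCohomology.extMap a M N i)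

/-!
Write `𝔞 = (v_1, …, v_r)`. The support of `H^{n+d-1}_𝔞(M, N)` is contained in the union of
`{𝔪}` and the set of contractions to `R` of the minimal primes of the associated graded ring
`gr_𝔞(R) = ⊕ 𝔞^k / 𝔞^(k+1)`, which is finite because `gr_𝔞(R)` is Noetherian. Primes not
containing `𝔞` are harmless, so let `p ⊇ 𝔞` be a prime outside this set. Two facts show that `p`
is not in the support.

* *The analytic spread of `𝔞` at `p` is smaller than `ht p`.* No minimal prime of `gr_𝔞(R)` lies
  over `p`, so a chain of primes in the fibre of `gr_𝔞(R)` over `p` can be prolonged downwards in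
  `gr_𝔞(R)`, and once more, by a prime not containing `u = T⁻¹`, in the extended Rees algebra
  `R[𝔞T, T⁻¹]`. Presenting the latter as a quotient of `R[Y_1, …, Y_r, u]` turns this into a count
  of heights in a polynomial ring (`card_le_height_ker`, `card_add_one_le_height`,
  `card_add_two_le_height`, bounded above by `height_comap_constantCoeff_le`). Homogeneous prime
  avoidance (`exists_mem_reesForms_notMem`) then provides at most `ht p - 1` forms whose ideal in
  the fibre is primary to the irrelevant ideal locally at the origin (`exists_forms_le_height`).
  By Nakayama their coefficients `x_j ∈ 𝔞` satisfy `γ 𝔞^t ⊆ (x_1, …, x_c)` for some `γ ∉ p`, where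
  `c + 1 ≤ ht p ≤ n - 1` (`exists_finset_card_add_one_le_height`).

* *If `𝔟` is generated by `c` elements, then `H^i_𝔟(M, N) = 0` for `i > c + pd M`.* This is
  proved by adjoining the generators one by one, using the sequences
  `0 → y^k Y → Y → Y / y^k Y → 0` with `Y = M / 𝔞^m M`
  (`ExtQuotEventuallyZero.sup_span_singleton`, `extQuotEventuallyZero_span`).

With `𝔟 = (x_1, …, x_c)` the index `n + d - 1` exceeds `c + d`, and multiplication by `γ^m` sends
`M / 𝔞^(tm) M` to `M / 𝔟^m M`, so that every element of `H^{n+d-1}_𝔞(M, N)` is killed by a power of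
`γ` (`ExtQuotEventuallyZero.exists_pow_smul_eq_zero`). No localization of `Ext` is involved.
-/

/-! ### Pullbacks of extension classes -/

/-- The pullback `f^* : Ext^i(Y, Z) → Ext^i(X, Z)` along a linear map `f : X → Y`. -/
noncomputable abbrev extPullback {R : Type u} [CommRing R] {X Y Z : Type u}
    [AddCommGroup X] [Module R X] [AddCommGroup Y] [Module R Y] [AddCommGroup Z] [Module R Z]
    {i : ℕ} (f : X →ₗ[R] Y) (ξ : Abelian.Ext (ModuleCat.of R Y) (ModuleCat.of R Z) i) :
    Abelian.Ext (ModuleCat.of R X) (ModuleCat.of R Z) i :=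
  (Abelian.Ext.mk₀ (ModuleCat.ofHom f)).comp ξ (zero_add i)

section ExtPullback

variable {R : Type u} [CommRing R] {W X Y Z : Type u}
  [AddCommGroup W] [Module R W] [AddCommGroup X] [Module R X] [AddCommGroup Y] [Module R Y]
  [AddCommGroup Z] [Module R Z]

lemma extPullback_comp {i : ℕ} (f : W →ₗ[R] X) (g : X →ₗ[R] Y)
    (ξ : Abelian.Ext (ModuleCat.of R Y) (ModuleCat.of R Z) i) :
    extPullback (g ∘ₗ f) ξ = extPullback f (extPullback g ξ) := by
  simp [extPullback]

lemma extPullback_zero {i : ℕ} (f : X →ₗ[R] Y) :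
    extPullback f (0 : Abelian.Ext (ModuleCat.of R Y) (ModuleCat.of R Z) i) = 0 := by
  simp [extPullback]

lemma extPullback_smul_left {i : ℕ} (r : R) (f : X →ₗ[R] Y)
    (ξ : Abelian.Ext (ModuleCat.of R Y) (ModuleCat.of R Z) i) :
    extPullback (r • f) ξ = r • extPullback f ξ := by
  have h : ModuleCat.ofHom (r • f) = r • ModuleCat.ofHom f := rfl
  rw [extPullback, extPullback, h, Abelian.Ext.mk₀_smul, Abelian.Ext.smul_comp]

lemma extPullback_id {i : ℕ} (ξ : Abelian.Ext (ModuleCat.of R Y) (ModuleCat.of R Z) i) :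
    extPullback LinearMap.id ξ = ξ := by
  simp [extPullback]

/-- The short complex `0 → S → Y → Y / S → 0` attached to a submodule. -/
noncomputable def submoduleShortComplex (S : Submodule R Y) : ShortComplex (ModuleCat.{u} R) :=
  ShortComplex.mk (ModuleCat.ofHom S.subtype) (ModuleCat.ofHom S.mkQ) (by
    ext x
    simp)

lemma submoduleShortComplex_shortExact (S : Submodule R Y) :
    (submoduleShortComplex S).ShortExact where
  exact := by
    rw [ShortComplex.ShortExact.moduleCat_exact_iff_function_exact]
    exact LinearMap.exact_subtype_mkQ S
  mono_f := (ModuleCat.mono_iff_injective _).2 S.injective_subtype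
  epi_g := (ModuleCat.epi_iff_surjective _).2 S.mkQ_surjective

/-- A class in `Ext^{j+1}(Y / S, Z)` that dies on `Y` comes from a class in `Ext^j(S, Z)`, and it
dies on `Y' / S'` as soon as the latter class dies on `S'`. -/
lemma exists_ext_submodule {j : ℕ} (S : Submodule R Y)
    (ξ : Abelian.Ext (ModuleCat.of R (Y ⧸ S)) (ModuleCat.of R Z) (j + 1))
    (hξ : extPullback S.mkQ ξ = 0) :
    ∃ η : Abelian.Ext (ModuleCat.of R S) (ModuleCat.of R Z) j,
      ∀ (Y' : Type u) [AddCommGroup Y'] [Module R Y'] (S' : Submodule R Y') (τ : Y' →ₗ[R] Y)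
        (h : S' ≤ S.comap τ), extPullback (τ.restrict h) η = 0 →
        extPullback (S'.mapQ S τ h) ξ = 0 := by
  obtain ⟨η, hη⟩ := Abelian.Ext.contravariant_sequence_exact₃
    (submoduleShortComplex_shortExact S) (ModuleCat.of R Z) ξ hξ (add_comm 1 j)
  refine ⟨η, fun Y' _ _ S' τ h h0 ↦ ?_⟩
  let F : submoduleShortComplex S' ⟶ submoduleShortComplex S :=
    { τ₁ := ModuleCat.ofHom (τ.restrict h)
      τ₂ := ModuleCat.ofHom τ
      τ₃ := ModuleCat.ofHom (S'.mapQ S τ h)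
      comm₁₂ := by ext; rfl
      comm₂₃ := by ext; rfl }
  have nat := ShortComplex.ShortExact.extClass_naturality
    (submoduleShortComplex_shortExact S') (submoduleShortComplex_shortExact S) F
  rw [← hη]
  change (Abelian.Ext.mk₀ F.τ₃).comp ((submoduleShortComplex_shortExact S).extClass.comp η _) _ = 0
  change (Abelian.Ext.mk₀ F.τ₁).comp η _ = 0 at h0
  rw [← Abelian.Ext.comp_assoc (h₁₂ := zero_add 1) (h := by omega), ← nat,
    Abelian.Ext.comp_assoc (h₂₃ := zero_add j) (h := by omega), h0, Abelian.Ext.comp_zero]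

end ExtPullback

/-! ### Vanishing of generalized local cohomology by the number of generators -/

section Vanishing

open GenLocalCohomology

/-- The elementwise form of `H^i_𝔞(M, N) = 0` for all `N` and all `i ≥ e`: every class in
`Ext^i(M / 𝔞^k M, N)` dies in some later term of the direct system. -/
def ExtQuotEventuallyZero {R : Type u} [CommRing R] (a : Ideal R) (M : Type u) [AddCommGroup M]
    [Module R M] (e : ℕ) : Prop :=
  ∀ (N : Type u) [AddCommGroup N] [Module R N] (i k : ℕ), e ≤ i → ∀ ξ : extQuot a M N i k,
    ∃ (m : ℕ) (h : k ≤ m), extPullback (quotMap a M h) ξ = 0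

variable {R : Type u} [CommRing R] {M : Type u} [AddCommGroup M] [Module R M]

lemma extQuotEventuallyZero_bot {e : ℕ} [HasProjectiveDimensionLT (ModuleCat.of R M) e] :
    ExtQuotEventuallyZero (⊥ : Ideal R) M e := by
  intro N _ _ i k hi ξ
  refine ⟨k + 1, Nat.le_succ k, ?_⟩
  have hbot : ((⊥ : Ideal R) ^ (k + 1) • ⊤ : Submodule R M) = ⊥ := by
    rw [pow_succ, Ideal.mul_bot, Submodule.bot_smul]
  let E := Submodule.quotEquivOfEqBot _ hbot
  have h0 : extPullback E.symm.toLinearMap (extPullback (quotMap ⊥ M (Nat.le_succ k)) ξ) = 0 :=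
    Abelian.Ext.eq_zero_of_hasProjectiveDimensionLT _ e hi
  have h1 := congrArg (extPullback E.toLinearMap) h0
  rwa [← extPullback_comp, extPullback_zero, LinearEquiv.symm_comp, extPullback_id] at h1

/-- Adjoining one element to the ideal shifts the vanishing range of generalized local cohomology
by one. -/
lemma ExtQuotEventuallyZero.sup_span_singleton [IsNoetherianRing R] [Module.Finite R M]
    {a : Ideal R} {e : ℕ} (H : ExtQuotEventuallyZero a M e) (y : R) :
    ExtQuotEventuallyZero (a ⊔ Ideal.span {y}) M (e + 1) := by
  obtain ⟨b, hb⟩ : ∃ b, b = a ⊔ Ideal.span {y} := ⟨_, rfl⟩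
  rw [← hb]
  intro N _ _ i k hi ξ
  obtain ⟨j, rfl⟩ : ∃ j, i = j + 1 := ⟨i - 1, by omega⟩
  have hab : ∀ l, (a ^ l • ⊤ : Submodule R M) ≤ b ^ l • ⊤ := fun l ↦
    Submodule.smul_mono_left (Ideal.pow_right_mono (hb ▸ le_sup_left) l)
  have hyb : y ∈ b := hb ▸ (le_sup_right : Ideal.span {y} ≤ a ⊔ _) (Ideal.mem_span_singleton_self y)
  obtain ⟨m, hkm, hm⟩ := H N (j + 1) k (by omega) (extPullback (Submodule.factor (hab k)) ξ)
  let Y := M ⧸ (a ^ m • ⊤ : Submodule R M)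
  let S : Submodule R Y := LinearMap.range (LinearMap.lsmul R Y (y ^ k))
  let π : Y →ₗ[R] M ⧸ (b ^ k • ⊤ : Submodule R M) := Submodule.factor (hab k) ∘ₗ quotMap a M hkm
  have hS : S ≤ LinearMap.ker π := by
    rintro _ ⟨z, rfl⟩
    obtain ⟨z, rfl⟩ := Submodule.mkQ_surjective _ z
    rw [LinearMap.mem_ker]
    change Submodule.Quotient.mk (y ^ k • z) = (0 : M ⧸ (b ^ k • ⊤ : Submodule R M))
    rw [Submodule.Quotient.mk_eq_zero]
    exact Submodule.smul_mem_smul (Ideal.pow_mem_pow hyb k) trivial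
  let ρ : Y ⧸ S →ₗ[R] M ⧸ (b ^ k • ⊤ : Submodule R M) := S.liftQ π hS
  have hρ : extPullback S.mkQ (extPullback ρ ξ) = 0 := by
    rw [← extPullback_comp, Submodule.liftQ_mkQ, extPullback_comp, hm]
  obtain ⟨η, hη⟩ := exists_ext_submodule S (extPullback ρ ξ) hρ
  obtain ⟨m', hmm', hm'⟩ := H N j m (by omega)
    (extPullback (LinearMap.rangeRestrict (LinearMap.lsmul R Y (y ^ k))) η)
  let Y' := M ⧸ (a ^ m' • ⊤ : Submodule R M)
  -- Beyond the exponent `t` the annihilators of the powers of `y` in `M / 𝔞^m' M` are constant.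
  obtain ⟨t, ht⟩ := monotone_stabilizes_iff_noetherian.mpr
    (inferInstance : IsNoetherian R Y') (LinearMap.iterateKer (LinearMap.lsmul R Y' y))
  have hpow : ∀ l, LinearMap.lsmul R Y' y ^ l = LinearMap.lsmul R Y' (y ^ l) := fun l ↦
    (map_pow (algebraMap R (Module.End R Y')) y l).symm
  have ht' : LinearMap.ker (LinearMap.lsmul R Y' (y ^ (k + t)))
      ≤ LinearMap.ker (LinearMap.lsmul R Y' (y ^ t)) := by
    have := ht (k + t) (by omega)
    change LinearMap.ker (LinearMap.lsmul R Y' y ^ t) =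
      LinearMap.ker (LinearMap.lsmul R Y' y ^ (k + t)) at this
    rw [← hpow, ← hpow, this]
  let S' : Submodule R Y' := LinearMap.range (LinearMap.lsmul R Y' (y ^ (k + t)))
  have hS' : S' ≤ S.comap (quotMap a M hmm') := by
    rintro _ ⟨z, rfl⟩
    refine ⟨y ^ t • quotMap a M hmm' z, ?_⟩
    simp only [LinearMap.lsmul_apply, map_smul, smul_smul, ← pow_add, add_comm]
  -- Division by `y^k`, well defined on `y^(k+t) Y'`.
  let β : S' →ₗ[R] Y' := Submodule.liftQ _ (LinearMap.lsmul R Y' (y ^ t)) ht' ∘ₗ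
    (LinearMap.quotKerEquivRange (LinearMap.lsmul R Y' (y ^ (k + t)))).symm.toLinearMap
  have hβ : ∀ z : Y', β ⟨y ^ (k + t) • z, ⟨z, rfl⟩⟩ = y ^ t • z := by
    intro z
    have : (LinearMap.quotKerEquivRange (LinearMap.lsmul R Y' (y ^ (k + t)))).symm
        ⟨y ^ (k + t) • z, ⟨z, rfl⟩⟩ = Submodule.Quotient.mk z := by
      rw [LinearEquiv.symm_apply_eq]
      rfl
    change Submodule.liftQ _ _ ht' (LinearEquiv.symm _ _) = _
    rw [this]
    rfl
  -- Hence the restriction of `Y' → Y` to `y^(k+t) Y' → y^k Y` factors through `Y' → Y → y^k Y`,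
  -- on which the class `η` dies.
  have hα : (quotMap a M hmm').restrict hS' =
      LinearMap.rangeRestrict (LinearMap.lsmul R Y (y ^ k)) ∘ₗ quotMap a M hmm' ∘ₗ β := by
    ext ⟨_, z, rfl⟩
    have := hβ z
    change quotMap a M hmm' (y ^ (k + t) • z) =
      y ^ k • quotMap a M hmm' (β ⟨y ^ (k + t) • z, ⟨z, rfl⟩⟩)
    rw [this, map_smul, map_smul, smul_smul, pow_add]
  have hzero := hη Y' S' (quotMap a M hmm') hS' (by
    rw [hα, extPullback_comp, extPullback_comp, hm', extPullback_zero])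
  have hb' : (b ^ (m' + (k + t)) • ⊤ : Submodule R M) ≤ LinearMap.ker (S'.mkQ ∘ₗ
      (a ^ m' • ⊤ : Submodule R M).mkQ) := by
    have h1 : b ^ (m' + (k + t)) ≤ a ^ m' ⊔ Ideal.span {y} ^ (k + t) := by
      rw [hb]
      exact Ideal.sup_pow_add_le_pow_sup_pow
    refine (Submodule.smul_mono_left h1).trans ?_
    rw [Submodule.sup_smul, Ideal.span_singleton_pow]
    refine sup_le ?_ ?_
    · intro z hz
      rw [LinearMap.mem_ker, LinearMap.comp_apply, Submodule.mkQ_apply (_ : Submodule R M),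
        (Submodule.Quotient.mk_eq_zero _).2 hz, map_zero]
    · rw [Submodule.smul_le]
      intro r hr z _
      obtain ⟨r, rfl⟩ := Ideal.mem_span_singleton'.1 hr
      rw [LinearMap.mem_ker, LinearMap.comp_apply]
      refine (Submodule.Quotient.mk_eq_zero _).2 ⟨Submodule.Quotient.mk (r • z), ?_⟩
      rw [mul_comm, mul_smul]
      rfl
  refine ⟨m' + (k + t), by omega, ?_⟩
  have hfac : quotMap b M (show k ≤ m' + (k + t) by omega) =
      ρ ∘ₗ S'.mapQ S (quotMap a M hmm') hS' ∘ₗ Submodule.liftQ _ _ hb' := by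
    ext z
    rfl
  rw [hfac, ← LinearMap.comp_assoc, extPullback_comp, extPullback_comp, hzero, extPullback_zero]

lemma extQuotEventuallyZero_span [IsNoetherianRing R] [Module.Finite R M] {e : ℕ}
    [HasProjectiveDimensionLT (ModuleCat.of R M) e] (s : Finset R) :
    ExtQuotEventuallyZero (Ideal.span (s : Set R)) M (e + s.card) := by
  classical
  induction s using Finset.induction_on with
  | empty => simpa using extQuotEventuallyZero_bot
  | insert y s hy ih =>
    rw [Finset.coe_insert, Ideal.span_insert, sup_comm, Finset.card_insert_of_notMem hy,
      ← add_assoc]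
    exact ih.sup_span_singleton y

/-- If `𝔟 ⊆ 𝔞`, `s 𝔞^t ⊆ 𝔟` and generalized local cohomology over `𝔟` vanishes in degree `i`, then
every element of `H^i_𝔞(M, N)` is killed by a power of `s`: multiplication by `s^m` maps
`M / 𝔞^(tm) M` to `M / 𝔟^m M`. -/
lemma ExtQuotEventuallyZero.exists_pow_smul_eq_zero {a b : Ideal R} {e : ℕ}
    (H : ExtQuotEventuallyZero b M e) (hba : b ≤ a) {s : R} {t : ℕ}
    (hs : ∀ z ∈ a ^ t, s * z ∈ b) (N : Type u) [AddCommGroup N] [Module R N] {i : ℕ} (hi : e ≤ i)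
    (z : GenLocalCohomology a M N i) : ∃ m : ℕ, s ^ m • z = 0 := by
  classical
  obtain ⟨k, ξ, rfl⟩ := Module.DirectLimit.exists_of z
  have hle : ∀ l, (b ^ l • ⊤ : Submodule R M) ≤ a ^ l • ⊤ := fun l ↦
    Submodule.smul_mono_left (Ideal.pow_right_mono hba l)
  obtain ⟨m, hkm, hm⟩ := H N i k hi (extPullback (Submodule.factor (hle k)) ξ)
  have hsub : Ideal.span {s ^ m} * a ^ (t * m) ≤ b ^ m := by
    rw [pow_mul, ← Ideal.span_singleton_pow, ← mul_pow]
    refine Ideal.pow_right_mono ?_ m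
    rw [Ideal.span_singleton_mul_le_iff]
    exact hs
  let T := t * m + k
  have hT : k ≤ T := Nat.le_add_left _ _
  have hker : (a ^ T • ⊤ : Submodule R M) ≤
      LinearMap.ker ((b ^ m • ⊤ : Submodule R M).mkQ ∘ₗ LinearMap.lsmul R M (s ^ m)) := by
    rw [Submodule.smul_le]
    intro r hr x _
    rw [LinearMap.mem_ker, LinearMap.comp_apply, LinearMap.lsmul_apply, smul_smul]
    refine (Submodule.Quotient.mk_eq_zero _).2 (Submodule.smul_mem_smul (hsub ?_) trivial)
    exact Ideal.mul_mem_mul (Ideal.mem_span_singleton_self _)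
      (Ideal.pow_le_pow_right (Nat.le_add_right _ _) hr)
  refine ⟨m, ?_⟩
  have hfac : s ^ m • quotMap a M hT =
      (Submodule.factor (hle k) ∘ₗ quotMap b M hkm) ∘ₗ Submodule.liftQ _ _ hker := by
    ext z
    rfl
  have key : s ^ m • extPullback (quotMap a M hT) ξ = 0 := by
    rw [← extPullback_smul_left, hfac, extPullback_comp, extPullback_comp, hm, extPullback_zero]
  rw [← Module.DirectLimit.of_f (hij := hT), ← map_smul]
  have : s ^ m • extMap a M N i k T hT ξ = 0 := key
  rw [this, map_zero]

/-- Generalized local cohomology is `𝔞`-torsion, since `𝔞^k` annihilates `M / 𝔞^k M`. -/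
lemma exists_pow_smul_genLocalCohomology_eq_zero {a : Ideal R} (N : Type u) [AddCommGroup N]
    [Module R N] {i : ℕ} {s : R} (hs : s ∈ a) (z : GenLocalCohomology a M N i) :
    ∃ m : ℕ, s ^ m • z = 0 := by
  classical
  obtain ⟨k, ξ, rfl⟩ := Module.DirectLimit.exists_of z
  refine ⟨k, ?_⟩
  have h0 : s ^ k • (LinearMap.id : (M ⧸ (a ^ k • ⊤ : Submodule R M)) →ₗ[R] _) = 0 := by
    ext x
    exact (Submodule.Quotient.mk_eq_zero _).2
      (Submodule.smul_mem_smul (Ideal.pow_mem_pow hs k) trivial)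
  have : s ^ k • ξ = 0 := by
    rw [← extPullback_id ξ, ← extPullback_smul_left, h0]
    simp [extPullback, ModuleCat.ofHom_zero]
  rw [← map_smul, this, map_zero]

end Vanishing

/-! ### Heights of primes in polynomial rings -/

section KernelHeight

open MvPolynomial

variable {R : Type*} [CommRing R] {ι : Type*} (v : ι → R)

/-- The kernel of a map `R[Y_i, u] → E` to a domain under which `u` becomes invertible and
`u Y_i` becomes a scalar has height at least the number of variables `Y_i`: specializing the
`Y_i` to their values one at a time gives a strictly increasing chain of primes. -/
lemma card_le_height_ker [Fintype ι] {E : Type*} [CommRing E] [IsDomain E] (g : R →+* E) {t t' : E}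
    (ht : t * t' = 1) :
    (Fintype.card ι : ℕ∞) ≤ (RingHom.ker (eval₂Hom g
      (fun o : Option ι ↦ o.elim t' (fun i ↦ g (v i) * t)))).height := by
  classical
  let ψ : Finset ι → MvPolynomial (Option ι) R →+* MvPolynomial ι E := fun s ↦
    eval₂Hom (C.comp g)
      (fun o ↦ o.elim (C t') (fun i ↦ if i ∈ s then C (g (v i) * t) else X i))
  have ht0 : t' ≠ 0 := right_ne_zero_of_mul_eq_one ht
  have key : ∀ s : Finset ι, (s.card : ℕ∞) ≤ (RingHom.ker (ψ s)).height := by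
    intro s
    induction s using Finset.induction_on with
    | empty => simp
    | insert j s hj ih =>
      have : (RingHom.ker (ψ s)).IsPrime := RingHom.ker_isPrime _
      have : (RingHom.ker (ψ (insert j s))).IsPrime := RingHom.ker_isPrime _
      have hlt : RingHom.ker (ψ s) < RingHom.ker (ψ (insert j s)) := by
        refine lt_of_le_of_ne ?_ fun h ↦ ?_
        · let σ : MvPolynomial ι E →+* MvPolynomial ι E :=
            eval₂Hom C (fun i ↦ if i = j then C (g (v i) * t) else X i)
          have hσ : ψ (insert j s) = σ.comp (ψ s) := by
            refine MvPolynomial.ringHom_ext (fun r ↦ by simp [ψ, σ]) fun o ↦ ?_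
            cases o with
            | none => simp [ψ, σ]
            | some i =>
              by_cases h1 : i = j
              · subst h1; simp [ψ, σ, hj]
              · by_cases h2 : i ∈ s <;> simp [ψ, σ, h1, h2]
          intro w hw
          rw [RingHom.mem_ker] at hw ⊢
          rw [hσ, RingHom.comp_apply, hw, map_zero]
        · have hmem : (X none * X (some j) - C (v j) : MvPolynomial (Option ι) R) ∈
              RingHom.ker (ψ (insert j s)) := by
            rw [RingHom.mem_ker]
            simp only [ψ, map_sub, map_mul, coe_eval₂Hom, eval₂_X, eval₂_C, Option.elim,
              Finset.mem_insert_self, if_true, RingHom.comp_apply]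
            rw [← map_mul, ← map_mul, ← map_sub, mul_left_comm, mul_comm t', ht, mul_one, sub_self,
              map_zero]
          rw [← h, RingHom.mem_ker] at hmem
          simp only [ψ, map_sub, map_mul, coe_eval₂Hom, eval₂_X, eval₂_C, Option.elim,
            hj, if_false, RingHom.comp_apply] at hmem
          have := congrArg (coeff (Finsupp.single j 1)) hmem
          rw [coeff_sub, coeff_C_mul, coeff_X, if_pos rfl, mul_one, coeff_C,
            if_neg (Finsupp.single_ne_zero.2 one_ne_zero).symm, sub_zero, coeff_zero] at this
          exact ht0 this
      rw [Finset.card_insert_of_notMem hj, Nat.cast_succ]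
      exact (add_le_add_left ih 1).trans (Ideal.height_add_one_le_of_lt_of_isPrime hlt)
  have huniv : RingHom.ker (ψ Finset.univ) = RingHom.ker (eval₂Hom g
      (fun o : Option ι ↦ o.elim t' (fun i ↦ g (v i) * t))) := by
    have : ψ Finset.univ = (C : E →+* MvPolynomial ι E).comp (eval₂Hom g
        (fun o : Option ι ↦ o.elim t' (fun i ↦ g (v i) * t))) := by
      refine MvPolynomial.ringHom_ext (fun r ↦ by simp [ψ]) fun o ↦ ?_
      cases o <;> simp [ψ]
    rw [this]
    exact RingHom.ker_comp_of_injective _ (C_injective ι E)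
  rw [← huniv, ← Finset.card_univ]
  exact key _

lemma sub_C_constantCoeff_mem_span {σ : Type*} (w : MvPolynomial σ R) :
    w - C (constantCoeff w) ∈ Ideal.span (Set.range (X : σ → MvPolynomial σ R)) := by
  induction w using MvPolynomial.induction_on with
  | C r => simp
  | add p q hp hq =>
    convert add_mem hp hq using 1
    rw [map_add, map_add]
    ring
  | mul_X p i _ =>
    rw [map_mul, constantCoeff_X, mul_zero, map_zero, sub_zero]
    exact Ideal.mul_mem_left _ _ (Ideal.subset_span ⟨i, rfl⟩)

lemma height_comap_constantCoeff_le [IsNoetherianRing R] {σ : Type*} [Fintype σ]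
    (p : Ideal R) [p.IsPrime] :
    (p.comap (constantCoeff (σ := σ))).height ≤ p.height + Fintype.card σ := by
  have : (p.comap (constantCoeff (σ := σ))).LiesOver p := ⟨by ext r; simp [Ideal.mem_comap]⟩
  refine (Ideal.height_le_height_add_of_liesOver p _).trans ?_
  gcongr
  set M := p.comap (constantCoeff (σ := σ)) with hM
  set π := Ideal.Quotient.mk (p.map (algebraMap R (MvPolynomial σ R))) with hπ
  have hspan : M.map π = Ideal.span (Set.range fun i : σ ↦ π (X i)) := by
    refine le_antisymm ?_ ?_
    · rw [Ideal.map_le_iff_le_comap]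
      intro w hw
      have h1 : w - C (constantCoeff w) ∈ Ideal.span (Set.range (X : σ → MvPolynomial σ R)) :=
        sub_C_constantCoeff_mem_span w
      have h2 : π (C (constantCoeff w)) = 0 :=
        Ideal.Quotient.eq_zero_iff_mem.2 (Ideal.mem_map_of_mem _ hw)
      have h3 := Ideal.mem_map_of_mem π h1
      rw [map_sub, h2, sub_zero, Ideal.map_span, ← Set.range_comp] at h3
      exact h3
    · rw [Ideal.span_le]
      rintro _ ⟨i, rfl⟩
      exact Ideal.mem_map_of_mem _ (by simp [hM, Ideal.mem_comap])
  have hprime : (M.map π).IsPrime := by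
    refine Ideal.map_isPrime_of_surjective Ideal.Quotient.mk_surjective ?_
    rw [Ideal.mk_ker, Ideal.map_le_iff_le_comap]
    intro r hr
    simpa [hM, Ideal.mem_comap] using hr
  refine (Ideal.height_le_spanFinrank _ hprime.ne_top).trans ?_
  rw [hspan]
  have h1 := Submodule.spanFinrank_span_le_encard (R := MvPolynomial σ R ⧸ p.map (algebraMap R
    (MvPolynomial σ R))) (Set.range fun i : σ ↦ π (X i))
  refine h1.trans ?_
  rw [← Set.image_univ, ← ENat.card_eq_coe_fintype_card, ← Set.encard_univ]
  exact Set.encard_image_le _ _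

end KernelHeight

/-! ### The extended Rees algebra -/

section ExtendedRees

open LaurentPolynomial

variable {R : Type*} [CommRing R] {ι : Type*}

lemma LaurentPolynomial.coeff_mul_T (f : R[T;T⁻¹]) (n m : ℤ) :
    (f * T n).coeff m = f.coeff (m - n) := by
  rw [T, AddMonoidAlgebra.coeff_mul_single_eq_coeff_mul (m - n) (fun m' _ ↦ by omega), mul_one]

lemma LaurentPolynomial.coeff_C_mul (r : R) (f : R[T;T⁻¹]) (m : ℤ) :
    (C r * f).coeff m = r * f.coeff m := by
  rw [← LaurentPolynomial.smul_eq_C_mul]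
  simp

/-- The map `R[Y_i, u] → R[T, T⁻¹]`, `Y_i ↦ v_i T`, `u ↦ T⁻¹`, whose image is the extended Rees
algebra of the ideal generated by the family `v`. The variable `u` is `X none`. -/
noncomputable def extendedReesHom (v : ι → R) : MvPolynomial (Option ι) R →+* R[T;T⁻¹] :=
  MvPolynomial.eval₂Hom C (fun o ↦ o.elim (T (-1)) (fun i ↦ C (v i) * T 1))

variable (v : ι → R)

@[simp] lemma extendedReesHom_C (r : R) : extendedReesHom v (MvPolynomial.C r) = C r := by
  simp [extendedReesHom]

@[simp] lemma extendedReesHom_X_none : extendedReesHom v (MvPolynomial.X none) = T (-1) := by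
  simp [extendedReesHom]

@[simp] lemma extendedReesHom_X_some (i : ι) :
    extendedReesHom v (MvPolynomial.X (some i)) = C (v i) * T 1 := by
  simp [extendedReesHom]

lemma coeff_extendedReesHom_mem (w : MvPolynomial (Option ι) R) (t : ℤ) :
    (extendedReesHom v w).coeff t ∈ Ideal.span (Set.range v) ^ t.toNat := by
  induction w using MvPolynomial.induction_on generalizing t with
  | C r =>
    rw [extendedReesHom_C, C_apply]
    split_ifs with h
    · simp [h]
    · exact zero_mem _
  | add p q hp hq =>
    rw [map_add, AddMonoidAlgebra.coeff_add]
    exact add_mem (hp t) (hq t)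
  | mul_X p o hp =>
    rw [map_mul]
    cases o with
    | none =>
      rw [extendedReesHom_X_none, LaurentPolynomial.coeff_mul_T]
      exact Ideal.pow_le_pow_right (by omega) (hp _)
    | some i =>
      rw [extendedReesHom_X_some, mul_left_comm, LaurentPolynomial.coeff_C_mul,
        LaurentPolynomial.coeff_mul_T]
      refine Ideal.pow_le_pow_right (show t.toNat ≤ (t - 1).toNat + 1 by omega) ?_
      rw [pow_succ']
      exact Ideal.mul_mem_mul (Ideal.subset_span ⟨i, rfl⟩) (hp _)

lemma coeff_zero_extendedReesHom_sub_mem (w : MvPolynomial (Option ι) R) :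
    (extendedReesHom v w).coeff 0 - MvPolynomial.constantCoeff w ∈ Ideal.span (Set.range v) := by
  induction w using MvPolynomial.induction_on with
  | C r => simp [extendedReesHom_C, C_apply]
  | add p q hp hq =>
    rw [map_add, map_add, AddMonoidAlgebra.coeff_add]
    have := add_mem hp hq
    simp only [Finsupp.coe_add, Pi.add_apply]
    convert this using 1
    ring
  | mul_X p o hp =>
    rw [map_mul, map_mul, MvPolynomial.constantCoeff_X, mul_zero, sub_zero]
    cases o with
    | none =>
      rw [extendedReesHom_X_none, LaurentPolynomial.coeff_mul_T]
      simpa using coeff_extendedReesHom_mem v p (0 - -1)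
    | some i =>
      rw [extendedReesHom_X_some, mul_left_comm, LaurentPolynomial.coeff_C_mul]
      exact Ideal.mul_mem_right _ _ (Ideal.subset_span ⟨i, rfl⟩)

/-- The degree `N` part `𝔞^N T^N` of the Rees algebra is reached from the `N`-th power of the ideal
of the variables `Y_i`. -/
lemma exists_extendedReesHom_eq (N : ℕ) {z : R} (hz : z ∈ Ideal.span (Set.range v) ^ N) :
    ∃ w ∈ Ideal.span (Set.range fun i : ι ↦
        (MvPolynomial.X (some i) : MvPolynomial (Option ι) R)) ^ N,
      extendedReesHom v w = C z * T N := by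
  induction N generalizing z with
  | zero => exact ⟨MvPolynomial.C z, by simp, by simp⟩
  | succ N ih =>
    rw [pow_succ] at hz
    induction hz using Submodule.mul_induction_on' with
    | mem_mul_mem x hx y hy =>
      obtain ⟨w, hw, hwx⟩ := ih hx
      have : ∃ w' ∈ Ideal.span (Set.range fun i : ι ↦
          (MvPolynomial.X (some i) : MvPolynomial (Option ι) R)),
          extendedReesHom v w' = C y * T 1 := by
        induction hy using Submodule.span_induction with
        | mem y hy =>
          obtain ⟨i, rfl⟩ := hy
          exact ⟨_, Ideal.subset_span ⟨i, rfl⟩, by simp⟩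
        | zero => exact ⟨0, zero_mem _, by simp⟩
        | add y y' _ _ h h' =>
          obtain ⟨w, hw, e⟩ := h
          obtain ⟨w', hw', e'⟩ := h'
          exact ⟨w + w', add_mem hw hw', by rw [map_add, e, e', map_add, add_mul]⟩
        | smul r y _ h =>
          obtain ⟨w, hw, e⟩ := h
          exact ⟨MvPolynomial.C r * w, Ideal.mul_mem_left _ _ hw, by
            rw [map_mul, e, extendedReesHom_C, smul_eq_mul, map_mul, mul_assoc]⟩
      obtain ⟨w', hw', hwy⟩ := this
      refine ⟨w * w', by rw [pow_succ]; exact Ideal.mul_mem_mul hw hw', ?_⟩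
      rw [map_mul, hwx, hwy, map_mul, Nat.cast_succ, T_add]
      ring
    | add x _ y _ h h' =>
      obtain ⟨w, hw, e⟩ := h
      obtain ⟨w', hw', e'⟩ := h'
      exact ⟨w + w', add_mem hw hw', by rw [map_add, e, e', map_add, add_mul]⟩

/-- A prime of `R[Y_i, u]` that contains the relations of the extended Rees algebra and `u` has
height at least `r + 1`, where `r` is the number of variables `Y_i`. -/
lemma card_add_one_le_height [Fintype ι] {P : Ideal (MvPolynomial (Option ι) R)} [P.IsPrime]
    (h : RingHom.ker (extendedReesHom v) ≤ P) (hu : MvPolynomial.X none ∈ P) :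
    (Fintype.card ι : ℕ∞) + 1 ≤ P.height := by
  obtain ⟨P', hP', hle⟩ := Ideal.exists_minimalPrimes_le h
  obtain ⟨q, hq, -, rfl⟩ := Ideal.exists_comap_eq_of_mem_minimalPrimes (extendedReesHom v) P' hP'
  let π := Ideal.Quotient.mk q
  have hker : q.comap (extendedReesHom v) = RingHom.ker (MvPolynomial.eval₂Hom (π.comp C)
      (fun o : Option ι ↦ o.elim (π (T (-1))) (fun i ↦ (π.comp C) (v i) * π (T 1)))) := by
    have : MvPolynomial.eval₂Hom (π.comp C) (fun o : Option ι ↦ o.elim (π (T (-1)))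
        (fun i ↦ (π.comp C) (v i) * π (T 1))) = π.comp (extendedReesHom v) := by
      refine MvPolynomial.ringHom_ext (fun r ↦ by simp) fun o ↦ ?_
      cases o <;> simp
    rw [this, ← RingHom.comap_ker, Ideal.mk_ker]
  have hcard : (Fintype.card ι : ℕ∞) ≤ (q.comap (extendedReesHom v)).height := by
    rw [hker]
    refine card_le_height_ker v (π.comp C) ?_
    rw [← map_mul, ← T_add]
    simp
  have hlt : q.comap (extendedReesHom v) < P := by
    refine lt_of_le_of_ne hle fun h ↦ ?_
    rw [← h, Ideal.mem_comap, extendedReesHom_X_none] at hu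
    exact hq.ne_top (Ideal.eq_top_of_isUnit_mem _ hu (isUnit_T _))
  exact (add_le_add_left hcard 1).trans (Ideal.height_add_one_le_of_lt_of_isPrime hlt)

end ExtendedRees

/-! ### The fibres of the associated graded ring and homogeneous parameters -/

section Forms

open LaurentPolynomial

variable {R : Type*} [CommRing R] {ι : Type*} (v : ι → R)

/-- The elements of `R[Y_i, u]` whose image in the extended Rees algebra is homogeneous of positive
degree. -/
def reesForms : Set (MvPolynomial (Option ι) R) :=
  {f | ∃ (s : ℕ) (x : R), 1 ≤ s ∧ extendedReesHom v f = C x * T s}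

variable {v}

lemma X_some_mem_reesForms (i : ι) :
    (MvPolynomial.X (some i) : MvPolynomial (Option ι) R) ∈ reesForms v :=
  ⟨1, v i, le_rfl, by simp⟩

lemma mul_mem_reesForms {f g : MvPolynomial (Option ι) R} (hf : f ∈ reesForms v)
    (hg : g ∈ reesForms v) : f * g ∈ reesForms v := by
  obtain ⟨s, x, hs, e⟩ := hf
  obtain ⟨s', x', hs', e'⟩ := hg
  refine ⟨s + s', x * x', by omega, ?_⟩
  rw [map_mul, e, e', map_mul, Nat.cast_add, T_add]
  ring

/-- Homogeneous prime avoidance. The primes themselves need not be homogeneous. -/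
lemma exists_mem_reesForms_notMem (A : Finset (Ideal (MvPolynomial (Option ι) R)))
    (hprime : ∀ Q ∈ A, Q.IsPrime) (hX : ∀ Q ∈ A, ∃ i, MvPolynomial.X (some i) ∉ Q)
    (hne : A.Nonempty) :
    ∃ f ∈ reesForms v, ∀ Q ∈ A, f ∉ Q := by
  classical
  induction hA : A.card using Nat.strong_induction_on generalizing A with
  | _ n ih =>
    obtain ⟨Q, hQ⟩ := hne
    have := hprime Q hQ
    obtain ⟨i, hi⟩ := hX Q hQ
    rcases (A.erase Q).eq_empty_or_nonempty with hempty | hne'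
    · refine ⟨_, X_some_mem_reesForms i, fun Q' hQ' ↦ ?_⟩
      have : Q' = Q := by
        by_contra h
        exact Finset.notMem_empty Q' (hempty ▸ Finset.mem_erase.2 ⟨h, hQ'⟩)
      rwa [this]
    have hsub : ∀ Q', ∀ P ∈ A.erase Q', P ∈ A := fun Q' P hP ↦ Finset.mem_of_mem_erase hP
    -- If every form in `P` lies in `Q`, then avoiding `Q` already forces avoiding `P`.
    by_cases hcase : ∃ P ∈ A.erase Q, ∀ f ∈ reesForms v, f ∈ P → f ∈ Q
    · obtain ⟨P, hP, hPQ⟩ := hcase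
      have hQP : Q ∈ A.erase P :=
        Finset.mem_erase.2 ⟨(Finset.ne_of_mem_erase hP).symm, hQ⟩
      obtain ⟨f, hf, hfQ⟩ := ih _ (hA ▸ Finset.card_erase_lt_of_mem (hsub _ _ hP)) (A.erase P)
        (fun P' h ↦ hprime P' (hsub _ _ h)) (fun P' h ↦ hX P' (hsub _ _ h)) ⟨Q, hQP⟩ rfl
      refine ⟨f, hf, fun P' hP' ↦ ?_⟩
      by_cases h : P' = P
      · rw [h]
        exact fun hfP ↦ hfQ Q hQP (hPQ f hf hfP)
      · exact hfQ P' (Finset.mem_erase.2 ⟨h, hP'⟩)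
    · push Not at hcase
      choose! g hg hgP hgQ using hcase
      obtain ⟨f, hf, hfP⟩ := ih _ (hA ▸ Finset.card_erase_lt_of_mem hQ) (A.erase Q)
        (fun P' h ↦ hprime P' (hsub _ _ h)) (fun P' h ↦ hX P' (hsub _ _ h)) hne' rfl
      by_cases hfQ : f ∈ Q
      swap
      · refine ⟨f, hf, fun P' hP' ↦ ?_⟩
        by_cases h : P' = Q
        · rwa [h]
        · exact hfP P' (Finset.mem_erase.2 ⟨h, hP'⟩)
      -- Otherwise some form `G` lies in all the other primes but not in `Q`; it corrects `f` once
      -- the two forms are raised to powers of the same degree.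
      have hprod : ∀ B ⊆ A.erase Q, ∃ G ∈ reesForms v, G ∉ Q ∧ ∀ P ∈ B, G ∈ P := by
        intro B
        induction B using Finset.induction_on with
        | empty => exact fun _ ↦ ⟨_, X_some_mem_reesForms i, hi, by simp⟩
        | insert P B _ ihB =>
          intro hle
          obtain ⟨G, hG, hGQ, hGP⟩ := ihB ((Finset.subset_insert _ _).trans hle)
          have hP := hle (Finset.mem_insert_self P B)
          refine ⟨g P * G, mul_mem_reesForms (hg P hP) hG, fun h ↦ ?_, fun P' hP' ↦ ?_⟩
          · exact (this.mem_or_mem h).elim (hgQ P hP) hGQ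
          · rcases Finset.mem_insert.1 hP' with rfl | hP'
            · exact Ideal.mul_mem_right _ _ (hgP P' hP)
            · exact Ideal.mul_mem_left _ _ (hGP P' hP')
      specialize hprod _ subset_rfl
      obtain ⟨G, ⟨s', x', hs', e'⟩, hGQ, hGP⟩ := hprod
      obtain ⟨s, x, hs, e⟩ := hf
      refine ⟨f ^ s' + G ^ s, ⟨s' * s, x ^ s' + x' ^ s, Nat.mul_pos hs' hs, ?_⟩, fun P hP ↦ ?_⟩
      · rw [map_add, map_pow, map_pow, e, e', mul_pow, mul_pow, T_pow, T_pow, map_add, map_pow,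
          map_pow, Nat.cast_mul, add_mul, mul_comm (s : ℤ)]
      · by_cases h : P = Q
        · rw [h]
          intro hmem
          have := hprime Q hQ
          refine hGQ (this.mem_of_pow_mem s ?_)
          exact (Ideal.add_mem_iff_right _ (Ideal.pow_mem_of_mem _ hfQ _ hs')).1 hmem
        · have hPe := Finset.mem_erase.2 ⟨h, hP⟩
          intro hmem
          have := hprime P hP
          refine hfP P hPe (this.mem_of_pow_mem s' ?_)
          exact (Ideal.add_mem_iff_left _ (Ideal.pow_mem_of_mem _ (hGP P hPe) _ hs)).1 hmem

variable (v)

/-- The ideal of `R[Y_i, u]` that cuts out the fibre over `p` of the associated graded ring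
`gr_𝔞(R) = R[𝔞T, T⁻¹] / (T⁻¹)`. -/
noncomputable def fiberIdeal (p : Ideal R) : Ideal (MvPolynomial (Option ι) R) :=
  RingHom.ker (extendedReesHom v) ⊔ Ideal.span {MvPolynomial.X none} ⊔ p.map MvPolynomial.C

/-- The contractions to `R` of the minimal primes of the associated graded ring `gr_𝔞(R)`, written
as a quotient of `R[Y_i, u]`. -/
def gradedMinimalPrimes : Set (Ideal R) :=
  Ideal.comap MvPolynomial.C ''
    (RingHom.ker (extendedReesHom v) ⊔ Ideal.span {MvPolynomial.X none}).minimalPrimes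

lemma gradedMinimalPrimes_finite [IsNoetherianRing R] [Finite ι] :
    (gradedMinimalPrimes v).Finite :=
  (Ideal.finite_minimalPrimes_of_isNoetherianRing _ _).image _

variable {v}

/-- If `p` is not the contraction of a minimal prime of `gr_𝔞(R)`, then a prime of the fibre over
`p` is not minimal in `gr_𝔞(R)`, and this adds one to the bound on its height. -/
lemma card_add_two_le_height [Fintype ι] {p : Ideal R} (hp : p ∉ gradedMinimalPrimes v)
    {Q : Ideal (MvPolynomial (Option ι) R)} [Q.IsPrime] (hQ : fiberIdeal v p ≤ Q)
    (hQp : Q ≤ p.comap MvPolynomial.constantCoeff) :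
    (Fintype.card ι : ℕ∞) + 2 ≤ Q.height := by
  have hle : RingHom.ker (extendedReesHom v) ⊔ Ideal.span {MvPolynomial.X none} ≤ Q :=
    le_sup_left.trans hQ
  obtain ⟨P, hP, hPQ⟩ := Ideal.exists_minimalPrimes_le hle
  have hPprime : P.IsPrime := hP.1.1
  have hlt : P < Q := by
    refine lt_of_le_of_ne hPQ ?_
    rintro rfl
    refine hp ⟨P, hP, le_antisymm (fun r hr ↦ ?_) (fun r hr ↦ ?_)⟩
    · simpa [Ideal.mem_comap] using hQp hr
    · exact hQ (Ideal.mem_sup_right (Ideal.mem_map_of_mem _ hr))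
  have h1 := card_add_one_le_height v (le_sup_left.trans hP.1.2)
    (hP.1.2 (Ideal.mem_sup_right (Ideal.mem_span_singleton_self _)))
  calc (Fintype.card ι : ℕ∞) + 2 = Fintype.card ι + 1 + 1 := by rw [add_assoc]; rfl
    _ ≤ P.height + 1 := add_le_add_left h1 1
    _ ≤ Q.height := Ideal.height_add_one_le_of_lt_of_isPrime hlt

lemma comap_constantCoeff_le {p : Ideal R} {Q : Ideal (MvPolynomial (Option ι) R)}
    (hQ : fiberIdeal v p ≤ Q) (hX : ∀ i, MvPolynomial.X (some i) ∈ Q) :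
    p.comap MvPolynomial.constantCoeff ≤ Q := by
  intro w hw
  have h1 : Ideal.span (Set.range (MvPolynomial.X : Option ι → MvPolynomial (Option ι) R)) ≤ Q := by
    rw [Ideal.span_le]
    rintro _ ⟨o, rfl⟩
    cases o with
    | none => exact hQ (Ideal.mem_sup_left (Ideal.mem_sup_right
        (Ideal.mem_span_singleton_self _)))
    | some i => exact hX i
  have h2 : MvPolynomial.C (MvPolynomial.constantCoeff w) ∈ Q :=
    hQ (Ideal.mem_sup_right (Ideal.mem_map_of_mem _ hw))
  simpa using add_mem (h1 (sub_C_constantCoeff_mem_span w)) h2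

/-- Partial homogeneous systems of parameters for the fibre over `p`: each form raises the height
of the remaining primes below the origin by one. -/
lemma exists_forms_le_height [IsNoetherianRing R] [Fintype ι] {p : Ideal R}
    (hp : p ∉ gradedMinimalPrimes v) (c : ℕ) :
    ∃ F : Finset (MvPolynomial (Option ι) R), F.card ≤ c ∧ ↑F ⊆ reesForms v ∧
      ∀ Q : Ideal (MvPolynomial (Option ι) R), Q.IsPrime →
        fiberIdeal v p ⊔ Ideal.span (F : Set _) ≤ Q →
        Q ≤ p.comap MvPolynomial.constantCoeff → Q ≠ p.comap MvPolynomial.constantCoeff →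
        (Fintype.card ι : ℕ∞) + 2 + c ≤ Q.height := by
  classical
  induction c with
  | zero =>
    refine ⟨∅, by simp, by simp, fun Q _ hQ hQp _ ↦ ?_⟩
    simpa using card_add_two_le_height hp (le_sup_left.trans hQ) hQp
  | succ c ih =>
    obtain ⟨F, hFc, hF, hFQ⟩ := ih
    set M := p.comap (MvPolynomial.constantCoeff (σ := Option ι)) with hM
    have hfin : ((fiberIdeal v p ⊔ Ideal.span (F : Set _)).minimalPrimes ∩
        {Q | Q ≤ M ∧ Q ≠ M}).Finite :=
      (Ideal.finite_minimalPrimes_of_isNoetherianRing _ _).inter_of_left _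
    rcases hfin.toFinset.eq_empty_or_nonempty with hempty | hne
    · refine ⟨F, by omega, hF, fun Q hQprime hQ hQp hQM ↦ ?_⟩
      obtain ⟨P, hP, hPQ⟩ := Ideal.exists_minimalPrimes_le hQ
      have : P ∈ hfin.toFinset := hfin.mem_toFinset.2 ⟨hP, hPQ.trans hQp, fun h ↦
        hQM (le_antisymm hQp (h ▸ hPQ))⟩
      simp [hempty] at this
    obtain ⟨f, hf, hfP⟩ := exists_mem_reesForms_notMem (v := v) hfin.toFinset
      (fun Q hQ ↦ (hfin.mem_toFinset.1 hQ).1.1.1) (fun Q hQ ↦ by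
        obtain ⟨hQ, hQM, hne⟩ := hfin.mem_toFinset.1 hQ
        by_contra! h
        exact hne (le_antisymm hQM (comap_constantCoeff_le (le_sup_left.trans hQ.1.2) h))) hne
    refine ⟨insert f F, (Finset.card_insert_le _ _).trans (by omega), ?_, ?_⟩
    · rw [Finset.coe_insert]
      exact Set.insert_subset hf hF
    intro Q hQprime hQ hQp hQM
    rw [Finset.coe_insert, Ideal.span_insert] at hQ
    obtain ⟨P, hP, hPQ⟩ := Ideal.exists_minimalPrimes_le
      (show fiberIdeal v p ⊔ Ideal.span (F : Set _) ≤ Q from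
        (sup_le_sup_left le_sup_right _).trans hQ)
    have hPprime : P.IsPrime := hP.1.1
    have hPM : P ≠ M := fun h ↦ hQM (le_antisymm hQp (h ▸ hPQ))
    have hlt : P < Q := by
      refine lt_of_le_of_ne hPQ fun h ↦ ?_
      refine hfP P (hfin.mem_toFinset.2 ⟨hP, hPQ.trans hQp, hPM⟩) ?_
      rw [h]
      exact hQ (Ideal.mem_sup_right (Ideal.mem_sup_left (Ideal.mem_span_singleton_self f)))
    rw [Nat.cast_succ, ← add_assoc]
    exact (add_le_add_left (hFQ P hPprime hP.1.2 (hPQ.trans hQp) hPM) 1).trans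
      (Ideal.height_add_one_le_of_lt_of_isPrime hlt)

/-- Taking the degree `t` part of an element of the ideal generated by the fibre ideal and some
forms `f` with `f ↦ x_f T^(s_f)`. -/
lemma coeff_extendedReesHom_mem_of_mem {p : Ideal R} (hp : Ideal.span (Set.range v) ≤ p)
    {F : Set (MvPolynomial (Option ι) R)} {deg : MvPolynomial (Option ι) R → ℕ}
    {x : MvPolynomial (Option ι) R → R}
    (hx : ∀ f ∈ F, extendedReesHom v f = C (x f) * T (deg f))
    {w : MvPolynomial (Option ι) R} (hw : w ∈ fiberIdeal v p ⊔ Ideal.span F) (t : ℕ) :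
    (extendedReesHom v w).coeff t ∈
      p * Ideal.span (Set.range v) ^ t ⊔ Ideal.span (x '' F) := by
  obtain ⟨w₁, h₁, w₂, h₂, rfl⟩ := Submodule.mem_sup.1 hw
  obtain ⟨w₃, h₃, w₄, h₄, rfl⟩ := Submodule.mem_sup.1 h₁
  obtain ⟨w₅, h₅, w₆, h₆, rfl⟩ := Submodule.mem_sup.1 h₃
  have e₅ : extendedReesHom v w₅ = 0 := h₅
  rw [map_add, map_add, map_add, AddMonoidAlgebra.coeff_add, AddMonoidAlgebra.coeff_add,
    AddMonoidAlgebra.coeff_add, e₅]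
  clear hw h₁ h₃
  refine add_mem (add_mem (add_mem (zero_mem _) ?_) ?_) ?_
  · obtain ⟨q, rfl⟩ := Ideal.mem_span_singleton'.1 h₆
    rw [map_mul, extendedReesHom_X_none, LaurentPolynomial.coeff_mul_T]
    refine Ideal.mem_sup_left (Ideal.mul_mono_left hp ?_)
    rw [← pow_succ']
    simpa using coeff_extendedReesHom_mem v q (t + 1 : ℕ)
  · refine Ideal.mem_sup_left ?_
    suffices ∀ w', (extendedReesHom v (w' * w₄)).coeff t ∈ p * Ideal.span (Set.range v) ^ t by
      simpa using this 1
    induction h₄ using Submodule.span_induction with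
    | mem y hy =>
      obtain ⟨r, hr, rfl⟩ := hy
      intro w'
      rw [mul_comm w', map_mul, extendedReesHom_C, LaurentPolynomial.coeff_C_mul]
      exact Ideal.mul_mem_mul hr (coeff_extendedReesHom_mem v w' t)
    | zero => simp
    | add y y' _ _ h h' =>
      intro w'
      rw [mul_add, map_add, AddMonoidAlgebra.coeff_add]
      exact add_mem (h w') (h' w')
    | smul b y _ h =>
      intro w'
      rw [smul_eq_mul, ← mul_assoc]
      exact h _
  · refine Ideal.mem_sup_right ?_
    suffices ∀ w', (extendedReesHom v (w' * w₂)).coeff t ∈ Ideal.span (x '' F) by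
      simpa using this 1
    induction h₂ using Submodule.span_induction with
    | mem y hy =>
      intro w'
      rw [mul_comm w', map_mul, hx y hy, mul_assoc, LaurentPolynomial.coeff_C_mul]
      exact Ideal.mul_mem_right _ _ (Ideal.subset_span ⟨y, hy, rfl⟩)
    | zero => simp
    | add y y' _ _ h h' =>
      intro w'
      rw [mul_add, map_add, AddMonoidAlgebra.coeff_add]
      exact add_mem (h w') (h' w')
    | smul b y _ h =>
      intro w'
      rw [smul_eq_mul, ← mul_assoc]
      exact h _

end Forms

/-! ### Generating the ideal up to radical locally at a prime -/

section Reduction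

lemma exists_notMem_forall_mul_mem {R : Type*} [CommRing R] (p : Ideal R) [p.IsPrime]
    {I J : Ideal R} (hJ : J.FG) (h : ∀ z ∈ J, ∃ γ ∉ p, γ * z ∈ I) :
    ∃ γ ∉ p, ∀ z ∈ J, γ * z ∈ I := by
  classical
  obtain ⟨S, rfl⟩ := hJ
  choose! γ hγ hγI using h
  refine ⟨∏ z ∈ S, γ z, fun hmem ↦ ?_, fun z hz ↦ ?_⟩
  · obtain ⟨z, hz, h⟩ := (Ideal.IsPrime.prod_mem_iff).1 hmem
    exact hγ z (Ideal.subset_span hz) h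
  · induction hz using Submodule.span_induction with
    | mem z hz =>
      rw [← Finset.prod_erase_mul S γ hz, mul_assoc]
      exact Ideal.mul_mem_left _ _ (hγI z (Ideal.subset_span hz))
    | zero => simp
    | add x y _ _ hx hy =>
      rw [mul_add]
      exact add_mem hx hy
    | smul b x _ hx =>
      rw [smul_eq_mul, mul_left_comm]
      exact Ideal.mul_mem_left _ _ hx

/-- Nakayama's lemma at a prime `p`, with denominators cleared. -/
lemma exists_notMem_mul_mem_of_le_smul_sup {R : Type*} [CommRing R] (p : Ideal R) [p.IsPrime]
    {I J : Ideal R} (hJ : J.FG) (h : ∀ z ∈ J, ∃ γ ∉ p, γ * z ∈ p * J ⊔ I) :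
    ∃ γ ∉ p, ∀ z ∈ J, γ * z ∈ I := by
  let A := Localization.AtPrime p
  have hle : J.map (algebraMap R A) ≤
      I.map (algebraMap R A) ⊔ p.map (algebraMap R A) • J.map (algebraMap R A) := by
    rw [smul_eq_mul, ← Ideal.map_mul, ← Ideal.map_sup, sup_comm, Ideal.map_le_iff_le_comap]
    intro z hz
    rw [Ideal.mem_comap, IsLocalization.algebraMap_mem_map_algebraMap_iff p.primeCompl]
    obtain ⟨γ, hγ, hγz⟩ := h z hz
    exact ⟨γ, hγ, hγz⟩
  have hjac : p.map (algebraMap R A) ≤ (⊥ : Ideal A).jacobson := by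
    rw [Localization.AtPrime.map_eq_maximalIdeal]
    exact IsLocalRing.maximalIdeal_le_jacobson _
  have key : J.map (algebraMap R A) ≤ I.map (algebraMap R A) :=
    Submodule.le_of_le_smul_of_le_jacobson_bot (Ideal.FG.map hJ (algebraMap R A)) hjac hle
  refine exists_notMem_forall_mul_mem p hJ fun z hz ↦ ?_
  have := key (Ideal.mem_map_of_mem (algebraMap R A) hz)
  rw [IsLocalization.algebraMap_mem_map_algebraMap_iff p.primeCompl] at this
  obtain ⟨γ, hγ, h⟩ := this
  exact ⟨γ, hγ, h⟩

/-- If `M` is the only prime between `I` and `M`, then every ideal inside `M` that is finitely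
generated has a power contained in `I` locally at `M`. -/
lemma exists_pow_forall_exists_mul_mem {W : Type*} [CommRing W] {I M K : Ideal W} [M.IsPrime]
    (hM : ∀ Q : Ideal W, Q.IsPrime → I ≤ Q → Q ≤ M → Q = M) (hK : K ≤ M) (hKfg : K.FG) :
    ∃ t : ℕ, ∀ w ∈ K ^ t, ∃ g ∉ M, g * w ∈ I := by
  let A := Localization.AtPrime M
  have hrad : K.map (algebraMap W A) ≤ (I.map (algebraMap W A)).radical := by
    rw [Ideal.radical_eq_sInf]
    refine le_sInf fun Q ⟨hIQ, hQ⟩ ↦ ?_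
    have hQM : Q.comap (algebraMap W A) = M :=
      hM _ (hQ.comap _) (Ideal.map_le_iff_le_comap.1 hIQ)
        ((Ideal.comap_mono (IsLocalRing.le_maximalIdeal hQ.ne_top)).trans
          Localization.AtPrime.under_maximalIdeal.le)
    rw [Ideal.map_le_iff_le_comap, hQM]
    exact hK
  obtain ⟨t, ht⟩ := Ideal.exists_pow_le_of_le_radical_of_fg hrad (hKfg.map _)
  refine ⟨t, fun w hw ↦ ?_⟩
  have : algebraMap W A w ∈ I.map (algebraMap W A) := by
    refine ht ?_
    rw [← Ideal.map_pow]
    exact Ideal.mem_map_of_mem _ hw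
  rw [IsLocalization.algebraMap_mem_map_algebraMap_iff M.primeCompl] at this
  obtain ⟨γ, hγ, h⟩ := this
  exact ⟨γ, hγ, h⟩

/-- Outside the finite set of contractions of minimal primes of `gr_𝔞(R)`, the analytic spread of
`𝔞` at `p` is less than the height of `p`. In particular, locally at `p`, the ideal `𝔞` agrees up
to radical with an ideal generated by at most `ht p - 1` of its elements. -/
theorem exists_finset_card_add_one_le_height {R : Type*} [CommRing R] [IsNoetherianRing R]
    {ι : Type*} [Fintype ι] (v : ι → R) (p : Ideal R) [p.IsPrime]
    (hvp : Ideal.span (Set.range v) ≤ p) (hp : p ∉ gradedMinimalPrimes v) :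
    ∃ S : Finset R, (S.card : ℕ∞) + 1 ≤ p.height ∧ (S : Set R) ⊆ Ideal.span (Set.range v) ∧
      ∃ γ ∉ p, ∃ t : ℕ, ∀ z ∈ Ideal.span (Set.range v) ^ t, γ * z ∈ Ideal.span (S : Set R) := by
  classical
  set M := p.comap (MvPolynomial.constantCoeff (σ := Option ι) (R := R)) with hM
  have hMp : M.IsPrime := inferInstance
  obtain ⟨h, hh⟩ : ∃ h : ℕ, p.height = h :=
    ENat.ne_top_iff_exists.1 (Ideal.height_ne_top ‹p.IsPrime›.ne_top) |>.imp fun _ e ↦ e.symm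
  have hMheight : M.height ≤ ((h + (Fintype.card ι + 1) : ℕ) : ℕ∞) := by
    have := height_comap_constantCoeff_le (σ := Option ι) p
    rw [hh, Fintype.card_option] at this
    exact_mod_cast this
  have hfib : fiberIdeal v p ≤ M := by
    refine sup_le (sup_le (fun w hw ↦ ?_) ?_) ?_
    · have h1 := coeff_zero_extendedReesHom_sub_mem v w
      rw [RingHom.mem_ker] at hw
      rw [hw] at h1
      exact (Ideal.neg_mem_iff _).1 (hvp (by simpa using h1))
    · rw [Ideal.span_singleton_le_iff_mem]
      simp [hM, Ideal.mem_comap]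
    · rw [Ideal.map_le_iff_le_comap]
      intro r hr
      simpa [hM, Ideal.mem_comap] using hr
  -- For `ht p = 0` the subtraction in `h - 1` below would truncate.
  have hpos : 1 ≤ h := by
    have h1 := (card_add_two_le_height hp hfib le_rfl).trans hMheight
    have h2 : Fintype.card ι + 2 ≤ h + (Fintype.card ι + 1) := by exact_mod_cast h1
    omega
  obtain ⟨F, hFc, hF, hFQ⟩ := exists_forms_le_height hp (h - 1)
  have honly : ∀ Q : Ideal (MvPolynomial (Option ι) R), Q.IsPrime →
      fiberIdeal v p ⊔ Ideal.span (F : Set _) ≤ Q → Q ≤ M → Q = M := by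
    intro Q hQ hle hQM
    by_contra hne
    have h1 := hFQ Q hQ hle hQM hne
    have h2 := Ideal.height_add_one_le_of_lt_of_isPrime (lt_of_le_of_ne hQM hne)
    have h3 := ((add_le_add_left h1 1).trans h2).trans hMheight
    have h4 : Fintype.card ι + 2 + (h - 1) + 1 ≤ h + (Fintype.card ι + 1) := by exact_mod_cast h3
    omega
  set K : Ideal (MvPolynomial (Option ι) R) :=
    Ideal.span (Set.range fun i : ι ↦ MvPolynomial.X (some i)) with hK
  have hKM : K ≤ M := by
    rw [hK, Ideal.span_le]
    rintro _ ⟨i, rfl⟩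
    simp [hM]
  obtain ⟨t, ht⟩ := exists_pow_forall_exists_mul_mem honly hKM (IsNoetherian.noetherian K)
  have hF' : ∀ f ∈ F, ∃ (s : ℕ) (x : R), 1 ≤ s ∧
      extendedReesHom v f = LaurentPolynomial.C x * LaurentPolynomial.T s := fun f hf ↦ hF hf
  choose! deg x hdeg hx using hF'
  have hloc : ∃ γ ∉ p, ∀ z ∈ Ideal.span (Set.range v) ^ t, γ * z ∈ Ideal.span (x '' F) := by
    refine exists_notMem_mul_mem_of_le_smul_sup p (IsNoetherian.noetherian _) fun z hz ↦ ?_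
    obtain ⟨w, hw, hwz⟩ := exists_extendedReesHom_eq v t hz
    obtain ⟨g, hg, hgw⟩ := ht w hw
    -- Compare the coefficients of `T^t` in the image of `g * w`.
    refine ⟨(extendedReesHom v g).coeff 0, fun hmem ↦ hg ?_, ?_⟩
    · have h1 := hvp (coeff_zero_extendedReesHom_sub_mem v g)
      simpa [hM] using sub_mem hmem h1
    · have h1 := coeff_extendedReesHom_mem_of_mem hvp hx hgw t
      rw [map_mul, hwz, mul_left_comm, LaurentPolynomial.coeff_C_mul,
        LaurentPolynomial.coeff_mul_T, sub_self, mul_comm z] at h1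
      exact h1
  obtain ⟨γ, hγ, hγt⟩ := hloc
  refine ⟨F.image x, ?_, ?_, γ, hγ, t, ?_⟩
  · rw [hh]
    have := (Finset.card_image_le (s := F) (f := x)).trans hFc
    have : (F.image x).card + 1 ≤ h := by omega
    exact_mod_cast this
  · rw [Finset.coe_image]
    rintro _ ⟨f, hf, rfl⟩
    have h1 := coeff_extendedReesHom_mem v f (deg f)
    rw [hx f hf, LaurentPolynomial.coeff_C_mul, LaurentPolynomial.T_apply, if_pos rfl, mul_one] at h1
    refine Ideal.pow_le_self ?_ h1
    have := hdeg f hf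
    simp only [Int.toNat_natCast]
    omega
  · rwa [Finset.coe_image]

end Reduction



/-! ### Finiteness of the support -/

theorem theorem2p10 (R : Type u) [CommRing R] [IsNoetherianRing R] [IsLocalRing R]
    (a : Ideal R) (M N : Type u) [AddCommGroup M] [Module R M] [Module.Finite R M]
    [AddCommGroup N] [Module R N]
    (n d : ℕ) (hn : ringKrullDim R = n)
    (hd : projectiveDimension (ModuleCat.of R M) = d)
    (i : ℕ) (hi : i + 1 = n + d) :
    (Module.support R (GenLocalCohomology a M N i)).Finite := by
  obtain ⟨S, rfl⟩ : ∃ S : Finset R, Ideal.span (S : Set R) = a := IsNoetherian.noetherian a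
  have hrange : Set.range (fun x : S ↦ (x : R)) = S := by simp
  have hfin : (gradedMinimalPrimes (fun x : S ↦ (x : R)) ∪ {IsLocalRing.maximalIdeal R}).Finite :=
    (gradedMinimalPrimes_finite _).union (Set.finite_singleton _)
  have hproj : HasProjectiveDimensionLT (ModuleCat.of R M) (d + 1) :=
    (projectiveDimension_le_iff _ d).1 hd.le
  refine (hfin.preimage (f := PrimeSpectrum.asIdeal)
    (fun _ _ _ _ h ↦ PrimeSpectrum.ext h)).subset fun p hp ↦ ?_
  by_contra hnot
  simp only [Set.mem_preimage, Set.mem_union, Set.mem_singleton_iff, not_or] at hnot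
  obtain ⟨hgr, hmax⟩ := hnot
  refine Module.notMem_support_iff'.2 (fun z ↦ ?_) hp
  by_cases hap : Ideal.span (S : Set R) ≤ p.asIdeal
  · obtain ⟨B, hB, hBa, γ, hγ, t, ht⟩ := exists_finset_card_add_one_le_height
      (fun x : S ↦ (x : R)) p.asIdeal (by rwa [hrange]) hgr
    rw [hrange] at hBa ht
    have hlt : p.asIdeal < IsLocalRing.maximalIdeal R :=
      lt_of_le_of_ne (IsLocalRing.le_maximalIdeal p.2.ne_top) hmax
    have h1 : ((B.card : ℕ∞) + 1 + 1 : ℕ∞) ≤ (IsLocalRing.maximalIdeal R).height :=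
      (add_le_add_left hB 1).trans (Ideal.height_add_one_le_of_lt_of_isPrime hlt)
    have h2 : ((IsLocalRing.maximalIdeal R).height : WithBot ℕ∞) = n := by
      rw [IsLocalRing.maximalIdeal_height_eq_ringKrullDim, hn]
    have h3 : B.card + 1 + 1 ≤ n := by
      have h2' : (IsLocalRing.maximalIdeal R).height = (n : ℕ∞) := by exact_mod_cast h2
      rw [h2'] at h1
      exact_mod_cast h1
    obtain ⟨m, hm⟩ := (extQuotEventuallyZero_span (M := M) (e := d + 1) B).exists_pow_smul_eq_zero
      (Ideal.span_le.2 hBa) ht N (by omega) z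
    exact ⟨γ ^ m, fun h ↦ hγ (p.2.mem_of_pow_mem m h), hm⟩
  · obtain ⟨s, hs, hsp⟩ := SetLike.not_le_iff_exists.1 hap
    obtain ⟨m, hm⟩ := exists_pow_smul_genLocalCohomology_eq_zero N hs z
    exact ⟨s ^ m, fun h ↦ hsp (p.2.mem_of_pow_mem m h), hm⟩
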